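/- Let $N\ge 1$, let $\sigma_\theta^2\ge 0$, $\sigma_w^2>0$, $P_T>0$, $\gamma\in\mathbb R$, and for $i=1,\dots,N$ let $\sigma_{v,i}^2>0$ and $d_i>0$. Let the prediction mean square error $P_{n|n-1}$ and the threshold $\epsilon$ be fixed real numbers with $0<\epsilon<P_{n|n-1}$. Let $\tilde h_1,\dots,\tilde h_N$ be independent $\mathcal{CN}(0,1)$ random variables (circularly symmetric complex normal with $\mathbb E|\tilde h_i|^2=1$), and let the channel be $\mathbf h=(\tilde h_1/d_1^{\gamma},\dots,\tilde h_N/d_N^{\gamma})^T$, $\mathbf H=\mathrm{diag}(\mathbf h)$. Let $\mathbf V=\mathrm{diag}(\sigma_{v,1}^2,\dots,\sigma_{v,N}^2)$ and let $$\mathbf a_e=\sqrt{\tfrac{P_T}{N}}\left[\tfrac{1}{\sqrt{\sigma_\theta^2+\sigma_{v,1}^2}},\dots,\tfrac{1}{\sqrt{\sigma_\theta^2+\sigma_{v,N}^2}}\right]^T$$ be the equal-power transmit gain vector. The filtered mean square error of the Kalman filter is $$P_{n|n}=(1-k\,\mathbf a_e^H\mathbf h)\,P_{n|n-1},\qquad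 k=\frac{P_{n|n-1}\,\mathbf h^H\mathbf a_e}{\mathbf a_e^H\mathbf H\mathbf V\mathbf H^H\mathbf a_e+P_{n|n-1}\,\mathbf a_e^H\mathbf h\mathbf h^H\mathbf a_e+\sigma_w^2}.$$ Put $$\beta=\frac{P_{n|n-1}-\epsilon}{\epsilon P_{n|n-1}},\quad \tilde{\mathbf a}_e=\frac{\mathbf a_e}{\sqrt{P_T}},\quad \mathbf M=\mathrm{diag}\left\{\frac1{d_1^{\gamma}},\dots,\frac1{d_N^{\gamma}}\right\},\quad \mathbf Q=\mathrm{diag}\left\{\frac{\sigma_{v,i}^2}{N(\sigma_\theta^2+\sigma_{v,i}^2)d_i^{2\gamma}}\right\}_{i=1}^N,$$ and let $\lambda_1\ge\lambda_2\ge\dots\ge\lambda_N$ be the eigenvalues, with multiplicity, of the Hermitian matrix $\mathbf R=\mathbf M\tilde{\mathbf a}_e\tilde{\mathbf a}_e^H\mathbf M-\beta\mathbf Q$. Then $\lambda_i<0$ for $2\le i\le N$ (so only $\lambda_1$ can be positive), and the mean square error outage probability is $$\Pr\{P_{n|n}>\epsilon\}=\begin{cases}1-\dfrac{\lambda_1^{N-1}}{\prod_{l\ne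 1}(\lambda_1-\lambda_l)}\,\exp\left(-\dfrac{(P_{n|n-1}-\epsilon)\,\sigma_w^2}{\epsilon\,P_{n|n-1}\,P_T\,\lambda_1}\right), & \lambda_1>0,\\[2ex] 1, & \lambda_1\le 0.\end{cases}$$ -/

import Mathlib

open MeasureTheory ProbabilityTheory Matrix
open scoped NNReal ENNReal

namespace SensorNet

noncomputable section

/-- The circularly symmetric complex normal law `CN(0, v)`: real and imaginary parts are independent
centred real Gaussians, each of variance `v / 2` (so that the mean of `|z|²` is `v`). -/
def complexNormal (v : ℝ≥0) : Measure ℂ :=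
  ((gaussianReal 0 (v / 2)).prod (gaussianReal 0 (v / 2))).map fun p : ℝ × ℝ => (⟨p.1, p.2⟩ : ℂ)

variable {N : ℕ}

/-- The measurement noise covariance `V = diag(σ_{v,1}², …, σ_{v,N}²)`. -/
def noiseCov (σv2 : Fin N → ℝ) : Matrix (Fin N) (Fin N) ℂ :=
  Matrix.diagonal fun i => (σv2 i : ℂ)

/-- The denominator `aᴴ H V Hᴴ a + P aᴴ h hᴴ a + σ_w²` of the Kalman gain, with `H = diag h`;
`Ppred` is the prediction MSE. -/
def innovationVar (Ppred σw2 : ℝ) (σv2 : Fin N → ℝ) (a h : Fin N → ℂ) : ℂ :=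
  star a ⬝ᵥ ((Matrix.diagonal h * noiseCov σv2 * (Matrix.diagonal h)ᴴ) *ᵥ a)
    + Ppred * ((star a ⬝ᵥ h) * (star h ⬝ᵥ a)) + σw2

/-- The Kalman gain for the observation `y = aᴴ h θ + aᴴ H v + w`. -/
def kalmanGain (Ppred σw2 : ℝ) (σv2 : Fin N → ℝ) (a h : Fin N → ℂ) : ℂ :=
  Ppred * (star h ⬝ᵥ a) / innovationVar Ppred σw2 σv2 a h

/-- The filtered MSE `(1 - k aᴴ h) P`. The complex number whose real part is taken is real,
see `filteredMSE_coe`. -/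
def filteredMSE (Ppred σw2 : ℝ) (σv2 : Fin N → ℝ) (a h : Fin N → ℂ) : ℝ :=
  ((1 - kalmanGain Ppred σw2 σv2 a h * (star a ⬝ᵥ h)) * (Ppred : ℂ)).re

theorem filteredMSE_coe (Ppred σw2 : ℝ) (σv2 : Fin N → ℝ) (a h : Fin N → ℂ) :
    (filteredMSE Ppred σw2 σv2 a h : ℂ)
      = (1 - kalmanGain Ppred σw2 σv2 a h * (star a ⬝ᵥ h)) * (Ppred : ℂ) := by
  have h1 : star (star a ⬝ᵥ h) = star h ⬝ᵥ a := by
    rw [Matrix.star_dotProduct, star_star]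
  have h2 : star (star h ⬝ᵥ a) = star a ⬝ᵥ h := by rw [← h1, star_star]
  have h3 : star (star a ⬝ᵥ ((Matrix.diagonal h * noiseCov σv2 * (Matrix.diagonal h)ᴴ) *ᵥ a))
      = star a ⬝ᵥ ((Matrix.diagonal h * noiseCov σv2 * (Matrix.diagonal h)ᴴ) *ᵥ a) := by
    simp only [noiseCov, Matrix.diagonal_conjTranspose, Matrix.diagonal_mul_diagonal,
      dotProduct, Matrix.mulVec_diagonal, star_sum]
    refine Finset.sum_congr rfl fun i _ => ?_
    simp
    ring
  have h4 : star (innovationVar Ppred σw2 σv2 a h) = innovationVar Ppred σw2 σv2 a h := by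
    unfold innovationVar
    rw [star_add, star_add, h3, star_mul', star_mul', h1, h2]
    simp [mul_comm]
  refine Complex.conj_eq_iff_re.mp ?_
  rw [starRingEnd_apply, star_mul', star_sub, star_mul', h1, kalmanGain, star_div₀, h4, star_mul', h2]
  simp only [star_one, Complex.star_def, Complex.conj_ofReal]
  ring

/-- The equal-power transmit gain vector `a_e`. -/
def equalGain (PT σθ2 : ℝ) (σv2 : Fin N → ℝ) : Fin N → ℂ :=
  fun i => ((√(PT / N) * (1 / √(σθ2 + σv2 i)) : ℝ) : ℂ)

/-- The channel vector with entries `h̃_i / d_i ^ γ`. -/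
def channel (d : Fin N → ℝ) (γ : ℝ) (g : Fin N → ℂ) : Fin N → ℂ :=
  fun i => g i / ((d i ^ γ : ℝ) : ℂ)

/-- `β = (P - ε) / (ε P)` with `P` the prediction MSE. -/
def betaCoef (Ppred ε : ℝ) : ℝ := (Ppred - ε) / (ε * Ppred)

/-- `M = diag(1 / d_i ^ γ)`. -/
def pathLoss (d : Fin N → ℝ) (γ : ℝ) : Matrix (Fin N) (Fin N) ℂ :=
  Matrix.diagonal fun i => ((1 / d i ^ γ : ℝ) : ℂ)

/-- `Q = diag(σ_{v,i}² / (N (σ_θ² + σ_{v,i}²) d_i ^ (2γ)))`. -/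
def matQ (σθ2 : ℝ) (σv2 d : Fin N → ℝ) (γ : ℝ) : Matrix (Fin N) (Fin N) ℂ :=
  Matrix.diagonal fun i => ((σv2 i / (N * (σθ2 + σv2 i) * d i ^ (2 * γ)) : ℝ) : ℂ)

/-- The normalized gain vector `ã_e = a_e / √P_T`. -/
def normGain (PT σθ2 : ℝ) (σv2 : Fin N → ℝ) : Fin N → ℂ :=
  ((1 / √PT : ℝ) : ℂ) • equalGain PT σθ2 σv2

/-- `R = M ã_e ã_eᴴ M - β Q`. -/
def matR (Ppred ε PT σθ2 : ℝ) (σv2 d : Fin N → ℝ) (γ : ℝ) : Matrix (Fin N) (Fin N) ℂ :=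
  pathLoss d γ * vecMulVec (normGain PT σθ2 σv2) (star (normGain PT σθ2 σv2)) * pathLoss d γ
    - (betaCoef Ppred ε : ℂ) • matQ σθ2 σv2 d γ

theorem matR_isHermitian (Ppred ε PT σθ2 : ℝ) (σv2 d : Fin N → ℝ) (γ : ℝ) :
    (matR Ppred ε PT σθ2 σv2 d γ).IsHermitian := by
  have hM : (pathLoss d γ)ᴴ = pathLoss d γ := by
    rw [pathLoss, Matrix.diagonal_conjTranspose]
    congr 1; funext i; simp
  have hQ : (matQ σθ2 σv2 d γ)ᴴ = matQ σθ2 σv2 d γ := by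
    rw [matQ, Matrix.diagonal_conjTranspose]
    congr 1; funext i; simp
  unfold Matrix.IsHermitian matR
  rw [Matrix.conjTranspose_sub, Matrix.conjTranspose_mul, Matrix.conjTranspose_mul,
    Matrix.conjTranspose_vecMulVec, Matrix.conjTranspose_smul, hM, hQ, star_star, Matrix.mul_assoc]
  simp

/-- The eigenvalues `λ_1 ≥ … ≥ λ_N` of `R`, with multiplicity and in nonincreasing order;
`λ_1` has index `0`. -/
def eigR (Ppred ε PT σθ2 : ℝ) (σv2 d : Fin N → ℝ) (γ : ℝ) : Fin N → ℝ :=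
  fun i => (matR_isHermitian Ppred ε PT σθ2 σv2 d γ).eigenvalues₀
    (Fin.cast (Fintype.card_fin N).symm i)

end

end SensorNet

/-! Clearing the positive denominator turns outage into an upper bound on a Hermitian form in the
channel (`lt_filteredMSE_iff`). Dividing by `PT` and absorbing the path loss gives `zᴴ R z < t`,
where `z` is the unit-variance fading and `t = β σ_w² / P_T`. Independent standard complex normals
are invariant under unitary maps, because their joint characteristic function depends only on the
norm. Diagonalizing `R` therefore reduces the event to `∑ λ_i |z_i|² < t` with the same law of `z`.
Where the rank-one part of `R` vanishes, the form is `-β Q`, which is negative definite. A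
two-dimensional space meets the kernel of a linear functional nontrivially, so two nonnegative
eigenvalues cannot coexist (`eigR_neg`). If `λ_1 ≤ 0`, outage is certain. Otherwise the `|z_i|²` are
independent Exp(1). Given the other coordinates, the complement is an exponential tail in `|z_1|²`,
whose average is a product of Laplace transforms `1 / (1 - λ_i / λ_1)`. Coincident negative
eigenvalues cause no difficulty. -/

namespace SensorNet

/-! ### The standard complex normal law -/

lemma measurable_complex_mk : Measurable fun p : ℝ × ℝ => (⟨p.1, p.2⟩ : ℂ) :=
  Complex.measurableEquivRealProd.symm.measurable

instance (v : ℝ≥0) : IsProbabilityMeasure (complexNormal v) :=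
  Measure.isProbabilityMeasure_map measurable_complex_mk.aemeasurable

lemma gaussianPDF_half_mul (x y : ℝ) :
    gaussianPDF 0 (1 / 2) x * gaussianPDF 0 (1 / 2) y
      = ENNReal.ofReal (Real.pi⁻¹ * Real.exp (-(x ^ 2 + y ^ 2))) := by
  rw [gaussianPDF, gaussianPDF, ← ENNReal.ofReal_mul (gaussianPDFReal_nonneg _ _ _)]
  congr 1
  have h : √Real.pi * √Real.pi = Real.pi := Real.mul_self_sqrt Real.pi_pos.le
  have h' : √Real.pi ≠ 0 := (Real.sqrt_pos.mpr Real.pi_pos).ne'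
  have e : (2 * Real.pi * ((1 / 2 : ℝ≥0) : ℝ)) = Real.pi := by push_cast; ring
  have e' : (2 * ((1 / 2 : ℝ≥0) : ℝ)) = 1 := by push_cast; ring
  simp only [gaussianPDFReal, e, e']
  rw [mul_mul_mul_comm, ← mul_inv, h, ← Real.exp_add]
  congr 2
  ring

/-- The squared modulus of a standard complex normal variable is exponentially distributed. -/
lemma lintegral_normSq_complexNormal_one {f : ℝ → ℝ≥0∞} (hf : Measurable f) :
    ∫⁻ z, f (Complex.normSq z) ∂complexNormal 1
      = ∫⁻ x in Set.Ioi 0, ENNReal.ofReal (Real.exp (-x)) * f x := by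
  have hN : Measurable Complex.normSq := Complex.continuous_normSq.measurable
  have hF : Measurable fun p : ℝ × ℝ => f (p.1 ^ 2 + p.2 ^ 2) := by fun_prop
  rw [complexNormal, lintegral_map (f := fun z => f (Complex.normSq z)) (hf.comp hN) measurable_complex_mk]
  have e1 : ∀ p : ℝ × ℝ, Complex.normSq ⟨p.1, p.2⟩ = p.1 ^ 2 + p.2 ^ 2 := fun p => by
    simp [Complex.normSq_apply, sq]
  simp_rw [e1]
  rw [gaussianReal_of_var_ne_zero 0 (by norm_num),
    prod_withDensity (measurable_gaussianPDF _ _) (measurable_gaussianPDF _ _)]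
  simp_rw [gaussianPDF_half_mul]
  rw [lintegral_withDensity_eq_lintegral_mul _ (by fun_prop) hF]
  have e2 := lintegral_comp_polarCoord_symm fun p : ℝ × ℝ =>
    ENNReal.ofReal (Real.pi⁻¹ * Real.exp (-(p.1 ^ 2 + p.2 ^ 2))) * f (p.1 ^ 2 + p.2 ^ 2)
  simp only [Pi.mul_apply]
  rw [← Measure.volume_eq_prod, ← e2]
  have e3 : ∀ p : ℝ × ℝ, (polarCoord.symm p).1 ^ 2 + (polarCoord.symm p).2 ^ 2 = p.1 ^ 2 :=
    fun p => by
      simp only [polarCoord_symm_apply]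
      linear_combination p.1 ^ 2 * Real.cos_sq_add_sin_sq p.2
  simp_rw [e3]
  rw [polarCoord_target, Measure.volume_eq_prod, ← Measure.prod_restrict]
  -- The integrand is free of the angle; the factor `1` exhibits it as a radial function times an
  -- angular one.
  have e4 : ∀ p : ℝ × ℝ, ENNReal.ofReal p.1 •
      (ENNReal.ofReal (Real.pi⁻¹ * Real.exp (-p.1 ^ 2)) * f (p.1 ^ 2))
      = (ENNReal.ofReal p.1 • (ENNReal.ofReal (Real.pi⁻¹ * Real.exp (-p.1 ^ 2)) * f (p.1 ^ 2)))
        * 1 := fun p => (mul_one _).symm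
  rw [lintegral_congr e4, lintegral_prod_mul (f := fun r => ENNReal.ofReal r •
    (ENNReal.ofReal (Real.pi⁻¹ * Real.exp (-r ^ 2)) * f (r ^ 2)))
    (g := fun _ => 1) (by simp only [smul_eq_mul]; fun_prop) (by fun_prop)]
  have himg : (fun r : ℝ => r ^ 2) '' Set.Ioi 0 = Set.Ioi 0 := by
    ext x
    constructor
    · rintro ⟨r, hr, rfl⟩
      exact pow_pos (Set.mem_Ioi.mp hr) 2
    · intro hx
      exact ⟨√x, Real.sqrt_pos.mpr hx, Real.sq_sqrt (le_of_lt hx)⟩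
  -- Substitution `x = r²`: the Jacobian `2 r` matches the polar factor `r` times the angular length
  -- `2π` times the density constant `π⁻¹`.
  have e5 := lintegral_image_eq_lintegral_abs_deriv_mul (s := Set.Ioi (0 : ℝ))
    (f := fun r => r ^ 2) (f' := fun r => 2 * r) measurableSet_Ioi
    (fun x _ => by simpa using (hasDerivAt_pow 2 x).hasDerivWithinAt)
    (fun a ha b hb h => (pow_left_inj₀ (le_of_lt ha) (le_of_lt hb) two_ne_zero).mp h)
    fun x => ENNReal.ofReal (Real.exp (-x)) * f x
  rw [himg] at e5
  rw [e5, lintegral_one, Measure.restrict_apply_univ, Real.volume_Ioo,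
    ← lintegral_mul_const _ (by simp only [smul_eq_mul]; fun_prop)]
  refine setLIntegral_congr_fun measurableSet_Ioi fun r hr => ?_
  have hr : 0 < r := hr
  simp only [smul_eq_mul]
  rw [abs_of_pos (by positivity), ← mul_assoc, mul_right_comm, ← mul_assoc,
    ← ENNReal.ofReal_mul hr.le, ← ENNReal.ofReal_mul (by positivity),
    ← ENNReal.ofReal_mul (by positivity)]
  congr 2
  field_simp
  ring

lemma complexNormal_one_real_le_normSq {s : ℝ} (hs : 0 ≤ s) :
    (complexNormal 1).real {z | s ≤ Complex.normSq z} = Real.exp (-s) := by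
  have hN : Measurable Complex.normSq := Complex.continuous_normSq.measurable
  have h := lintegral_normSq_complexNormal_one
    (f := (Set.Ici s).indicator 1) (measurable_one.indicator measurableSet_Ici)
  have h1 : ∀ z : ℂ, (Set.Ici s).indicator (1 : ℝ → ℝ≥0∞) (Complex.normSq z)
      = {z : ℂ | s ≤ Complex.normSq z}.indicator 1 z := fun z => by
    simp [Set.indicator_apply]
  have h2 : ∀ x : ℝ, ENNReal.ofReal (Real.exp (-x)) * (Set.Ici s).indicator (1 : ℝ → ℝ≥0∞) x
      = (Set.Ici s).indicator (fun x => ENNReal.ofReal (Real.exp (-x))) x := fun x => by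
    by_cases hx : x ∈ Set.Ici s <;> simp [hx]
  simp_rw [h1, h2] at h
  rw [lintegral_indicator_one (measurableSet_le measurable_const hN),
    lintegral_indicator measurableSet_Ici, Measure.restrict_restrict measurableSet_Ici,
    ← ofReal_integral_eq_lintegral_ofReal] at h
  · rw [Measure.real, h, ENNReal.toReal_ofReal (integral_nonneg fun x => (Real.exp_pos _).le),
      ← integral_exp_neg_Ioi s]
    rcases hs.eq_or_lt with rfl | hs
    · rw [Set.inter_eq_right.mpr Set.Ioi_subset_Ici_self]
    · rw [Set.inter_eq_left.mpr (Set.Ici_subset_Ioi.mpr hs), integral_Ici_eq_integral_Ioi]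
  · exact (integrableOn_exp_neg_Ioi 0).mono_set Set.inter_subset_right
  · exact Filter.Eventually.of_forall fun x => (Real.exp_pos _).le

/-- Laplace transform of Exp(1); it averages out the coordinates with nonpositive coefficients. -/
lemma integral_exp_neg_mul_normSq_complexNormal_one {c : ℝ} (hc : 0 ≤ c) :
    ∫ z, Real.exp (-(c * Complex.normSq z)) ∂complexNormal 1 = (1 + c)⁻¹ := by
  have hN : Measurable Complex.normSq := Complex.continuous_normSq.measurable
  rw [integral_eq_lintegral_of_nonneg_ae
      (Filter.Eventually.of_forall fun x => (Real.exp_pos _).le)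
      (by fun_prop),
    lintegral_normSq_complexNormal_one (f := fun x => ENNReal.ofReal (Real.exp (-(c * x))))
      (by fun_prop)]
  simp_rw [← ENNReal.ofReal_mul (Real.exp_pos _).le, ← Real.exp_add]
  have h : ∀ x : ℝ, -x + -(c * x) = -(1 + c) * x := fun x => by ring
  simp_rw [h]
  rw [← integral_eq_lintegral_of_nonneg_ae
      (Filter.Eventually.of_forall fun x => (Real.exp_pos _).le) (by fun_prop),
    integral_exp_mul_Ioi (by linarith)]
  rw [mul_zero, Real.exp_zero, neg_div_neg_eq, one_div]

/-- Each real component has variance `1/2`, whence the `4`. Dependence on `‖t‖` alone is what yields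
unitary invariance. -/
lemma charFun_complexNormal_one (t : ℂ) :
    charFun (complexNormal 1) t = Complex.exp (-(‖t‖ : ℂ) ^ 2 / 4) := by
  rw [charFun_apply, complexNormal, integral_map measurable_complex_mk.aemeasurable (by fun_prop)]
  have h : ∀ p : ℝ × ℝ, Complex.exp ((inner ℝ (⟨p.1, p.2⟩ : ℂ) t : ℝ) * Complex.I)
      = Complex.exp (t.re * p.1 * Complex.I) * Complex.exp (t.im * p.2 * Complex.I) := fun p => by
    rw [← Complex.exp_add, ← add_mul]
    congr 2
    simp [Complex.inner]
  simp_rw [h]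
  rw [integral_prod_mul (fun x : ℝ => Complex.exp (t.re * x * Complex.I))
    (fun x : ℝ => Complex.exp (t.im * x * Complex.I)), ← charFun_apply_real, ← charFun_apply_real,
    charFun_gaussianReal, charFun_gaussianReal, ← Complex.exp_add]
  congr 1
  rw [← Complex.ofReal_pow ‖t‖, ← Complex.normSq_eq_norm_sq, Complex.normSq_apply]
  push_cast
  ring

/-! ### Independent complex normals: unitary invariance and tails of quadratic forms -/

variable {ι : Type*} [Fintype ι]

/-- Unitary invariance of the law of independent standard complex normal variables. -/
lemma map_linearIsometryEquiv_pi_complexNormal_one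
    (U : EuclideanSpace ℂ ι ≃ₗᵢ[ℂ] EuclideanSpace ℂ ι) :
    (Measure.pi fun _ : ι => complexNormal 1).map (fun z => (U (WithLp.toLp 2 z)).ofLp)
      = Measure.pi fun _ : ι => complexNormal 1 := by
  have hU : Measurable U := U.continuous.measurable
  have hT : Measurable (WithLp.toLp 2 : (ι → ℂ) → EuclideanSpace ℂ ι) := by fun_prop
  have hO : Measurable (WithLp.ofLp : EuclideanSpace ℂ ι → (ι → ℂ)) := by fun_prop
  set ν := (Measure.pi fun _ : ι => complexNormal 1).map
    (WithLp.toLp 2 : (ι → ℂ) → EuclideanSpace ℂ ι) with hν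
  have : IsProbabilityMeasure ν := Measure.isProbabilityMeasure_map hT.aemeasurable
  have : IsProbabilityMeasure (ν.map U) := Measure.isProbabilityMeasure_map hU.aemeasurable
  have hc : ∀ t, charFun ν t = Complex.exp (-(‖t‖ : ℂ) ^ 2 / 4) := fun t => by
    rw [hν, charFun_pi]
    simp_rw [charFun_complexNormal_one]
    rw [← Complex.exp_sum, ← Finset.sum_div, Finset.sum_neg_distrib]
    congr 3
    rw [← Complex.ofReal_pow, EuclideanSpace.norm_sq_eq]
    push_cast
    rfl
  have key : ν.map U = ν := by
    refine Measure.ext_of_charFun (funext fun t => ?_)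
    have h1 : charFun (ν.map U) t = charFun ν (U.symm t) := by
      rw [charFun_apply, integral_map hU.aemeasurable (by fun_prop), charFun_apply]
      refine integral_congr_ae (Filter.Eventually.of_forall fun x => ?_)
      -- The characteristic function uses the real inner product, so `U` is viewed as a real
      -- isometry.
      let V : EuclideanSpace ℂ ι →ₗᵢ[ℝ] EuclideanSpace ℂ ι :=
        ⟨U.toLinearEquiv.toLinearMap.restrictScalars ℝ, U.norm_map⟩
      have h2 : inner ℝ (U x) (U (U.symm t)) = inner ℝ x (U.symm t) := V.inner_map_map x (U.symm t)
      rw [U.apply_symm_apply] at h2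
      simp only [h2]
    rw [h1, hc, hc, U.symm.norm_map]
  calc _ = (ν.map U).map WithLp.ofLp := by
        rw [hν, Measure.map_map hU hT, Measure.map_map hO (hU.comp hT)]
        rfl
    _ = _ := by
        rw [key, hν, Measure.map_map hO hT]
        exact Measure.map_id

/-- Tail probability of a diagonal quadratic form in independent standard complex normal variables
with exactly one positive coefficient. -/
lemma pi_complexNormal_one_real_le_sum {n : ℕ} {lam : Fin (n + 1) → ℝ} (h0 : 0 < lam 0)
    (hneg : ∀ i : Fin n, lam i.succ ≤ 0) {t : ℝ} (ht : 0 ≤ t) :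
    (Measure.pi fun _ : Fin (n + 1) => complexNormal 1).real
        {z | t ≤ ∑ i, lam i * Complex.normSq (z i)}
      = Real.exp (-(t / lam 0)) * ∏ i : Fin n, (1 + -lam i.succ / lam 0)⁻¹ := by
  have hN : Measurable Complex.normSq := Complex.continuous_normSq.measurable
  have hmp := measurePreserving_piFinSuccAbove (fun _ : Fin (n + 1) => complexNormal 1) 0
  set S : Set (ℂ × (Fin n → ℂ)) :=
    {p | t ≤ lam 0 * Complex.normSq p.1 + ∑ i : Fin n, lam i.succ * Complex.normSq (p.2 i)} with hS
  have hSm : MeasurableSet S := measurableSet_le measurable_const (by fun_prop)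
  have hpre : {z : Fin (n + 1) → ℂ | t ≤ ∑ i, lam i * Complex.normSq (z i)}
      = MeasurableEquiv.piFinSuccAbove (fun _ => ℂ) 0 ⁻¹' S := by
    ext z
    simp [hS, Fin.sum_univ_succ, MeasurableEquiv.piFinSuccAbove, Fin.tail]
  rw [hpre, Measure.real, hmp.measure_preimage hSm.nullMeasurableSet, Measure.prod_apply_symm hSm,
    ← integral_toReal (measurable_measure_prodMk_right hSm).aemeasurable
      (Filter.Eventually.of_forall fun _ => measure_lt_top _ _)]
  -- With the other coordinates fixed, the event is a tail of `|z_0|²`; its threshold is nonnegative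
  -- because the remaining coefficients are nonpositive.
  have hslice : ∀ y : Fin n → ℂ, (complexNormal 1 ((fun x => (x, y)) ⁻¹' S)).toReal
      = Real.exp (-(t / lam 0)) *
        ∏ i : Fin n, Real.exp (-(-lam i.succ / lam 0 * Complex.normSq (y i))) := fun y => by
    have hs : 0 ≤ (t - ∑ i : Fin n, lam i.succ * Complex.normSq (y i)) / lam 0 := by
      refine div_nonneg (sub_nonneg.mpr (le_trans (Finset.sum_nonpos fun i _ => ?_) ht)) h0.le
      exact mul_nonpos_of_nonpos_of_nonneg (hneg i) (Complex.normSq_nonneg _)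
    have hset : (fun x => (x, y)) ⁻¹' S
        = {z | (t - ∑ i : Fin n, lam i.succ * Complex.normSq (y i)) / lam 0
            ≤ Complex.normSq z} := by
      ext x
      simp only [hS, Set.mem_preimage, Set.mem_ofPred_eq]
      rw [div_le_iff₀ h0, sub_le_iff_le_add, mul_comm]
    rw [hset, ← Measure.real, complexNormal_one_real_le_normSq hs, ← Real.exp_sum, ← Real.exp_add,
      sub_div, Finset.sum_div, Finset.sum_neg_distrib]
    congr 1
    have : ∀ i : Fin n, -lam i.succ / lam 0 * Complex.normSq (y i)
        = -(lam i.succ * Complex.normSq (y i) / lam 0) := fun i => by ring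
    simp_rw [this, Finset.sum_neg_distrib]
    ring
  simp_rw [hslice]
  rw [integral_const_mul, integral_fintype_prod_eq_prod
    (f := fun (i : Fin n) z => Real.exp (-(-lam i.succ / lam 0 * Complex.normSq z)))]
  congr 1
  refine Finset.prod_congr rfl fun i _ => integral_exp_neg_mul_normSq_complexNormal_one ?_
  exact div_nonneg (neg_nonneg.mpr (hneg i)) h0.le

/-! ### Diagonalization and the outage event as a quadratic inequality -/

variable {N : ℕ}

/-- Unitary diagonalization of a Hermitian form, with the eigenvalues in nonincreasing order. -/
lemma exists_linearIsometryEquiv_dotProduct_mulVec_eq {A : Matrix (Fin N) (Fin N) ℂ}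
    (hA : A.IsHermitian) :
    ∃ U : EuclideanSpace ℂ (Fin N) ≃ₗᵢ[ℂ] EuclideanSpace ℂ (Fin N), ∀ z : Fin N → ℂ,
      star z ⬝ᵥ (A *ᵥ z)
        = ((∑ i, hA.eigenvalues₀ (Fin.cast (Fintype.card_fin N).symm i)
            * Complex.normSq (U (WithLp.toLp 2 z) i) : ℝ) : ℂ) := by
  -- `eigenvalues` lists the sorted `eigenvalues₀` through a chosen equivalence; `σ` undoes it, so
  -- the eigenbasis follows the sorted order.
  let σ : Fin N ≃ Fin N := (finCongr (Fintype.card_fin N).symm).trans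
    (Fintype.equivOfCardEq (Fintype.card_fin (Fintype.card (Fin N))))
  have hσ : ∀ i, hA.eigenvalues (σ i) = hA.eigenvalues₀ (Fin.cast (Fintype.card_fin N).symm i) :=
    fun i => by simp [Matrix.IsHermitian.eigenvalues, σ]
  let b := hA.eigenvectorBasis.reindex σ.symm
  refine ⟨b.repr, fun z => ?_⟩
  have hb : ∀ i, A *ᵥ (b i).ofLp
      = (hA.eigenvalues₀ (Fin.cast (Fintype.card_fin N).symm i) : ℂ) • (b i).ofLp := fun i => by
    have := hA.mulVec_eigenvectorBasis (σ i)
    rw [hσ] at this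
    simpa [b] using this
  have hin : ∀ x y : Fin N → ℂ,
      inner ℂ (WithLp.toLp 2 x : EuclideanSpace ℂ (Fin N)) (WithLp.toLp 2 y) = star x ⬝ᵥ y :=
    fun x y => by rw [EuclideanSpace.inner_eq_star_dotProduct, dotProduct_comm]
  have hsymm : ∀ x y : Fin N → ℂ, star x ⬝ᵥ (A *ᵥ y) = star (A *ᵥ x) ⬝ᵥ y := fun x y => by
    rw [star_mulVec, hA.eq, dotProduct_mulVec]
  rw [← hin, ← b.sum_inner_mul_inner, Complex.ofReal_sum]
  refine Finset.sum_congr rfl fun i _ => ?_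
  have h1 : inner ℂ (b i) (WithLp.toLp 2 (A *ᵥ z))
      = (hA.eigenvalues₀ (Fin.cast (Fintype.card_fin N).symm i) : ℂ)
        * inner ℂ (b i) (WithLp.toLp 2 z) := by
    have h2 := hin (b i).ofLp (A *ᵥ z)
    have h3 := hin (b i).ofLp z
    rw [WithLp.toLp_ofLp] at h2 h3
    rw [h2, h3, hsymm, hb, star_smul, smul_dotProduct]
    simp
  rw [h1, b.repr_apply_apply, Complex.ofReal_mul, Complex.normSq_eq_conj_mul_self,
    inner_conj_symm]
  ring

lemma ofReal_innovationVar (Ppred σw2 : ℝ) (σv2 : Fin N → ℝ) (a h : Fin N → ℂ) :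
    innovationVar Ppred σw2 σv2 a h
      = (((∑ i, σv2 i * Complex.normSq (a i) * Complex.normSq (h i))
        + Ppred * Complex.normSq (star a ⬝ᵥ h) + σw2 : ℝ) : ℂ) := by
  have h1 : star h ⬝ᵥ a = star (star a ⬝ᵥ h) := by rw [Matrix.star_dotProduct]
  rw [innovationVar, h1]
  push_cast
  simp only [noiseCov, Matrix.diagonal_conjTranspose, Matrix.diagonal_mul_diagonal,
    dotProduct, Matrix.mulVec_diagonal, Complex.normSq_eq_conj_mul_self, Pi.star_apply,
    Complex.star_def]
  congr 2
  · exact Finset.sum_congr rfl fun i _ => by ring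
  · ring

/-- The outage event in terms of a quadratic form in the channel vector. -/
lemma lt_filteredMSE_iff {Ppred σw2 ε : ℝ} {σv2 : Fin N → ℝ} (hσw : 0 < σw2)
    (hσv : ∀ i, 0 < σv2 i) (hε : 0 < ε) (hεP : ε < Ppred) (a h : Fin N → ℂ) :
    ε < filteredMSE Ppred σw2 σv2 a h ↔
      Complex.normSq (star a ⬝ᵥ h)
        - betaCoef Ppred ε * ∑ i, σv2 i * Complex.normSq (a i) * Complex.normSq (h i)
      < betaCoef Ppred ε * σw2 := by
  have h1 : star h ⬝ᵥ a = star (star a ⬝ᵥ h) := by rw [Matrix.star_dotProduct]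
  set A := ∑ i, σv2 i * Complex.normSq (a i) * Complex.normSq (h i) with hA
  set B := Complex.normSq (star a ⬝ᵥ h) with hB
  have hA0 : 0 ≤ A := Finset.sum_nonneg fun i _ =>
    mul_nonneg (mul_nonneg (hσv i).le (Complex.normSq_nonneg _)) (Complex.normSq_nonneg _)
  have hB0 : 0 ≤ B := Complex.normSq_nonneg _
  have hP : 0 < Ppred := hε.trans hεP
  have hD : 0 < A + Ppred * B + σw2 := by positivity
  have h2 : filteredMSE Ppred σw2 σv2 a h = (1 - Ppred * B / (A + Ppred * B + σw2)) * Ppred := by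
    apply Complex.ofReal_injective
    rw [filteredMSE_coe, kalmanGain, ofReal_innovationVar, h1, ← hA, ← hB, div_mul_eq_mul_div,
      mul_assoc, Complex.star_def, ← Complex.normSq_eq_conj_mul_self, ← hB]
    push_cast
    rfl
  have h3 : (1 - Ppred * B / (A + Ppred * B + σw2)) * Ppred
      = (A + σw2) * Ppred / (A + Ppred * B + σw2) := by
    field_simp
    ring
  have hβ : betaCoef Ppred ε * (ε * Ppred) = Ppred - ε := by
    rw [betaCoef]
    field_simp
  -- Multiplying by `ε * Ppred` clears the denominator of `β`; both sides then read `ε P B < (P - ε)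
  -- (A + σ_w²)`.
  rw [h2, h3, lt_div_iff₀ hD, sub_lt_iff_lt_add, ← mul_add,
    ← mul_lt_mul_iff_of_pos_right (mul_pos hε hP) (b := B)]
  have h4 : betaCoef Ppred ε * (σw2 + A) * (ε * Ppred) = (Ppred - ε) * (σw2 + A) := by
    rw [← hβ]
    ring
  rw [h4]
  constructor <;> intro h <;> linarith

/-- The entries of the real vector `M ã_e`. -/
noncomputable def gainCoef (PT σθ2 : ℝ) (σv2 d : Fin N → ℝ) (γ : ℝ) (i : Fin N) : ℝ :=
  1 / d i ^ γ * (1 / √PT * (√(PT / N) * (1 / √(σθ2 + σv2 i))))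

/-- The diagonal entries of `Q`. -/
noncomputable def noiseCoef (σθ2 : ℝ) (σv2 d : Fin N → ℝ) (γ : ℝ) (i : Fin N) : ℝ :=
  σv2 i / (N * (σθ2 + σv2 i) * d i ^ (2 * γ))

lemma dotProduct_matR_mulVec (Ppred ε PT σθ2 : ℝ) (σv2 d : Fin N → ℝ) (γ : ℝ) (z : Fin N → ℂ) :
    star z ⬝ᵥ (matR Ppred ε PT σθ2 σv2 d γ *ᵥ z)
      = ((Complex.normSq (∑ i, (gainCoef PT σθ2 σv2 d γ i : ℂ) * z i)
        - betaCoef Ppred ε * ∑ i, noiseCoef σθ2 σv2 d γ i * Complex.normSq (z i) : ℝ) : ℂ) := by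
  have hM : pathLoss d γ * vecMulVec (normGain PT σθ2 σv2) (star (normGain PT σθ2 σv2))
      * pathLoss d γ = vecMulVec (fun i => (gainCoef PT σθ2 σv2 d γ i : ℂ))
        (fun i => (gainCoef PT σθ2 σv2 d γ i : ℂ)) := by
    ext i j
    simp [pathLoss, vecMulVec_apply, normGain, equalGain, gainCoef]
    ring
  rw [matR, hM, sub_mulVec, dotProduct_sub, Complex.ofReal_sub]
  congr 1
  · rw [vecMulVec_mulVec, Complex.normSq_eq_conj_mul_self]
    simp only [dotProduct, map_sum, map_mul, Complex.conj_ofReal, Finset.sum_mul, Pi.smul_apply,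
      Pi.star_apply, Complex.star_def, MulOpposite.smul_eq_mul_unop, MulOpposite.unop_op]
    exact Finset.sum_congr rfl fun i _ => by ring
  · rw [smul_mulVec, dotProduct_smul, Complex.ofReal_mul, smul_eq_mul]
    congr 1
    simp only [matQ, dotProduct, mulVec_diagonal, Complex.ofReal_sum, Complex.ofReal_mul,
      Complex.normSq_eq_conj_mul_self, noiseCoef, Pi.star_apply, Complex.star_def]
    exact Finset.sum_congr rfl fun i _ => by ring

lemma noiseCoef_pos {σθ2 : ℝ} {σv2 d : Fin N → ℝ} (γ : ℝ) (hσθ : 0 ≤ σθ2)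
    (hσv : ∀ i, 0 < σv2 i) (hd : ∀ i, 0 < d i) (i : Fin N) : 0 < noiseCoef σθ2 σv2 d γ i := by
  have hN : (0 : ℝ) < N := Nat.cast_pos.mpr (Fin.pos i)
  have h1 := hσv i
  have h2 := Real.rpow_pos_of_pos (hd i) (2 * γ)
  unfold noiseCoef
  positivity

/-- The normalized gains lose a factor `√PT`, so `PT` comes out of the signal term. It comes out of
the noise term in `sum_noise_channel` too, leaving it only in the threshold. -/
lemma normSq_dotProduct_channel {PT : ℝ} (hPT : 0 < PT) (σθ2 : ℝ) (σv2 d : Fin N → ℝ) (γ : ℝ)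
    (z : Fin N → ℂ) :
    Complex.normSq (star (equalGain PT σθ2 σv2) ⬝ᵥ channel d γ z)
      = PT * Complex.normSq (∑ i, (gainCoef PT σθ2 σv2 d γ i : ℂ) * z i) := by
  have hs : √PT ≠ 0 := (Real.sqrt_pos.mpr hPT).ne'
  have h : star (equalGain PT σθ2 σv2) ⬝ᵥ channel d γ z
      = (√PT : ℂ) * ∑ i, (gainCoef PT σθ2 σv2 d γ i : ℂ) * z i := by
    rw [Finset.mul_sum]
    refine Finset.sum_congr rfl fun i _ => ?_
    have e : gainCoef PT σθ2 σv2 d γ i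
        = (√PT)⁻¹ * ((√(PT / N) * (1 / √(σθ2 + σv2 i))) * (d i ^ γ)⁻¹) := by
      unfold gainCoef
      ring
    have hs' : (√PT : ℂ) ≠ 0 := Complex.ofReal_ne_zero.mpr hs
    rw [e, Pi.star_apply, equalGain, channel, Complex.star_def, Complex.conj_ofReal,
      Complex.ofReal_mul (√PT)⁻¹, Complex.ofReal_inv, mul_assoc, mul_inv_cancel_left₀ hs',
      Complex.ofReal_mul _ (d i ^ γ)⁻¹, Complex.ofReal_inv]
    ring
  rw [h, map_mul, Complex.normSq_ofReal, Real.mul_self_sqrt hPT.le]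

lemma sum_noise_channel {PT σθ2 : ℝ} {σv2 d : Fin N → ℝ} (hPT : 0 < PT) (hσθ : 0 ≤ σθ2)
    (hσv : ∀ i, 0 < σv2 i) (hd : ∀ i, 0 < d i) (γ : ℝ) (z : Fin N → ℂ) :
    ∑ i, σv2 i * Complex.normSq (equalGain PT σθ2 σv2 i) * Complex.normSq (channel d γ z i)
      = PT * ∑ i, noiseCoef σθ2 σv2 d γ i * Complex.normSq (z i) := by
  rw [Finset.mul_sum]
  refine Finset.sum_congr rfl fun i _ => ?_
  have hN : (0 : ℝ) < N := Nat.cast_pos.mpr (Fin.pos i)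
  have h1 := hσv i
  have h2 := Real.rpow_pos_of_pos (hd i) γ
  have h3 : 0 < σθ2 + σv2 i := by positivity
  have e1 : d i ^ (2 * γ) = d i ^ γ * d i ^ γ := by
    rw [two_mul, Real.rpow_add (hd i)]
  have e2 : (√(PT / N) * (1 / √(σθ2 + σv2 i))) * (√(PT / N) * (1 / √(σθ2 + σv2 i)))
      = PT / N * (1 / (σθ2 + σv2 i)) := by
    rw [mul_mul_mul_comm, Real.mul_self_sqrt (by positivity), div_mul_div_comm,
      Real.mul_self_sqrt h3.le, one_mul]
  rw [equalGain, channel, map_div₀, Complex.normSq_ofReal, Complex.normSq_ofReal, e2, noiseCoef, e1]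
  field_simp

/-! ### Signs of the eigenvalues -/

lemma betaCoef_pos {Ppred ε : ℝ} (hε : 0 < ε) (hεP : ε < Ppred) : 0 < betaCoef Ppred ε :=
  div_pos (sub_pos.mpr hεP) (mul_pos hε (hε.trans hεP))

lemma eigR_antitone (Ppred ε PT σθ2 : ℝ) (σv2 d : Fin N → ℝ) (γ : ℝ) :
    Antitone (eigR Ppred ε PT σθ2 σv2 d γ) := fun _ _ h =>
  (matR_isHermitian Ppred ε PT σθ2 σv2 d γ).eigenvalues₀_antitone h

/-- A Hermitian form that is negative on the nonzero vectors of the kernel of a linear functional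
has at most one nonnegative eigenvalue. -/
lemma neg_of_antitone_of_neg_on_ker [NeZero N] {lam : Fin N → ℝ} (hlam : Antitone lam)
    (c : EuclideanSpace ℂ (Fin N) →ₗ[ℂ] ℂ)
    (hc : ∀ w, w ≠ 0 → c w = 0 → ∑ i, lam i * Complex.normSq (w i) < 0)
    {i : Fin N} (hi : i ≠ 0) : lam i < 0 := by
  by_contra! h
  have h0 : 0 ≤ lam 0 := h.trans (hlam (Fin.zero_le i))
  -- If `lam i ≥ 0`, the form is nonnegative on the span of `e_0` and `e_i`, so that plane meets
  -- `ker c` only in zero.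
  have hpair : ∀ a b : ℂ,
      a * c (EuclideanSpace.single 0 1) + b * c (EuclideanSpace.single i 1) = 0 →
      a = 0 ∧ b = 0 := by
    intro a b hab
    by_contra hne
    set w : EuclideanSpace ℂ (Fin N) :=
      a • EuclideanSpace.single 0 1 + b • EuclideanSpace.single i 1 with hw
    have hw0 : w 0 = a := by simp [hw, hi.symm]
    have hwi : w i = b := by simp [hw, hi]
    have hwj : ∀ j, j ≠ 0 → j ≠ i → w j = 0 := fun j h1 h2 => by simp [hw, h1, h2]
    refine absurd (hc w (fun hz => hne ?_) (by simpa [hw] using hab)) (not_lt.mpr ?_)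
    · rw [← hw0, ← hwi, hz]
      simp
    · refine Finset.sum_nonneg fun j _ => ?_
      rcases eq_or_ne j 0 with rfl | h1
      · exact mul_nonneg h0 (Complex.normSq_nonneg _)
      rcases eq_or_ne j i with rfl | h2
      · exact mul_nonneg h (Complex.normSq_nonneg _)
      · simp [hwj j h1 h2]
  -- The vector `c(e_i) e_0 - c(e_0) e_i` always lies in `ker c`. Its vanishing forces `c(e_0) = 0`,
  -- which puts `e_0` itself in the kernel.
  have h1 := hpair (c (EuclideanSpace.single i 1)) (-c (EuclideanSpace.single 0 1)) (by ring)
  have h2 := hpair 1 0 (by rw [neg_eq_zero.mp h1.2]; ring)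
  exact one_ne_zero h2.1

/-- Unitary diagonalization of the form `z ↦ |(M ã_e)ᵀ z|² - β zᴴ Q z`. -/
lemma exists_linearIsometryEquiv_matR (Ppred ε PT σθ2 : ℝ) (σv2 d : Fin N → ℝ) (γ : ℝ) :
    ∃ U : EuclideanSpace ℂ (Fin N) ≃ₗᵢ[ℂ] EuclideanSpace ℂ (Fin N), ∀ z : Fin N → ℂ,
      Complex.normSq (∑ i, (gainCoef PT σθ2 σv2 d γ i : ℂ) * z i)
        - betaCoef Ppred ε * ∑ i, noiseCoef σθ2 σv2 d γ i * Complex.normSq (z i)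
      = ∑ i, eigR Ppred ε PT σθ2 σv2 d γ i * Complex.normSq (U (WithLp.toLp 2 z) i) := by
  obtain ⟨U, hU⟩ := exists_linearIsometryEquiv_dotProduct_mulVec_eq
    (matR_isHermitian Ppred ε PT σθ2 σv2 d γ)
  exact ⟨U, fun z => Complex.ofReal_injective
    ((dotProduct_matR_mulVec Ppred ε PT σθ2 σv2 d γ z).symm.trans (hU z))⟩

/-- Only the largest eigenvalue of `R` can be nonnegative. -/
lemma eigR_neg [NeZero N] {Ppred ε σθ2 : ℝ} {σv2 d : Fin N → ℝ} (PT γ : ℝ) (hσθ : 0 ≤ σθ2)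
    (hσv : ∀ i, 0 < σv2 i) (hd : ∀ i, 0 < d i) (hε : 0 < ε) (hεP : ε < Ppred)
    {i : Fin N} (hi : i ≠ 0) : eigR Ppred ε PT σθ2 σv2 d γ i < 0 := by
  obtain ⟨U, hU⟩ := exists_linearIsometryEquiv_matR Ppred ε PT σθ2 σv2 d γ
  -- The functional `z ↦ ∑ (M ã_e)_j z_j` behind the rank-one part, written in eigenbasis
  -- coordinates `w = U z`.
  let c : EuclideanSpace ℂ (Fin N) →ₗ[ℂ] ℂ :=
    ∑ j, (gainCoef PT σθ2 σv2 d γ j : ℂ) •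
      ((EuclideanSpace.proj j : EuclideanSpace ℂ (Fin N) →L[ℂ] ℂ) : _ →ₗ[ℂ] ℂ)
        ∘ₗ (U.symm.toLinearEquiv : EuclideanSpace ℂ (Fin N) →ₗ[ℂ] EuclideanSpace ℂ (Fin N))
  refine neg_of_antitone_of_neg_on_ker (eigR_antitone Ppred ε PT σθ2 σv2 d γ) c ?_ hi
  intro w hw hcw
  have h1 := hU (U.symm w).ofLp
  have h2 : ∑ j, (gainCoef PT σθ2 σv2 d γ j : ℂ) * (U.symm w).ofLp j = 0 := by
    simpa [c] using hcw
  rw [h2, map_zero, zero_sub, WithLp.toLp_ofLp, U.apply_symm_apply] at h1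
  rw [← h1, neg_lt_zero]
  refine mul_pos (betaCoef_pos hε hεP) ?_
  have hne : U.symm w ≠ 0 := fun h => hw (by simpa using h)
  obtain ⟨j, hj⟩ : ∃ j, (U.symm w).ofLp j ≠ 0 := by
    by_contra! h
    exact hne (by ext j; simpa using h j)
  exact Finset.sum_pos' (fun k _ => mul_nonneg (noiseCoef_pos γ hσθ hσv hd k).le
    (Complex.normSq_nonneg _)) ⟨j, Finset.mem_univ j,
      mul_pos (noiseCoef_pos γ hσθ hσv hd j) (Complex.normSq_pos.mpr hj)⟩

/-! ### The outage probability -/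

/-- The outage event after diagonalization. -/
lemma exists_linearIsometryEquiv_lt_filteredMSE_iff {Ppred σw2 ε PT σθ2 : ℝ} {σv2 d : Fin N → ℝ}
    (γ : ℝ) (hσθ : 0 ≤ σθ2) (hσw : 0 < σw2) (hPT : 0 < PT) (hσv : ∀ i, 0 < σv2 i)
    (hd : ∀ i, 0 < d i) (hε : 0 < ε) (hεP : ε < Ppred) :
    ∃ U : EuclideanSpace ℂ (Fin N) ≃ₗᵢ[ℂ] EuclideanSpace ℂ (Fin N), ∀ z : Fin N → ℂ,
      ε < filteredMSE Ppred σw2 σv2 (equalGain PT σθ2 σv2) (channel d γ z) ↔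
        ∑ i, eigR Ppred ε PT σθ2 σv2 d γ i * Complex.normSq (U (WithLp.toLp 2 z) i)
          < betaCoef Ppred ε * σw2 / PT := by
  obtain ⟨U, hU⟩ := exists_linearIsometryEquiv_matR Ppred ε PT σθ2 σv2 d γ
  refine ⟨U, fun z => ?_⟩
  rw [lt_filteredMSE_iff hσw hσv hε hεP, normSq_dotProduct_channel hPT,
    sum_noise_channel hPT hσθ hσv hd, ← hU z, lt_div_iff₀ hPT]
  refine Eq.to_iff (congrArg (· < _) ?_)
  ring

/-- The probability of the outage event for independent standard complex normal fading. -/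
lemma pi_complexNormal_one_real_sum_lt {n : ℕ} {lam : Fin (n + 1) → ℝ}
    (hneg : ∀ i, i ≠ 0 → lam i < 0) {t : ℝ} (ht : 0 < t) :
    (Measure.pi fun _ : Fin (n + 1) => complexNormal 1).real
        {z | ∑ i, lam i * Complex.normSq (z i) < t}
      = if 0 < lam 0 then
          1 - lam 0 ^ n / (∏ l ∈ Finset.univ.erase 0, (lam 0 - lam l)) * Real.exp (-(t / lam 0))
        else 1 := by
  have hN : Measurable Complex.normSq := Complex.continuous_normSq.measurable
  split_ifs with h0
  · have hm : MeasurableSet {z : Fin (n + 1) → ℂ | t ≤ ∑ i, lam i * Complex.normSq (z i)} :=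
      measurableSet_le measurable_const (by fun_prop)
    have hcompl : {z : Fin (n + 1) → ℂ | ∑ i, lam i * Complex.normSq (z i) < t}
        = {z | t ≤ ∑ i, lam i * Complex.normSq (z i)}ᶜ := by
      ext z
      simp
    rw [hcompl, probReal_compl_eq_one_sub hm,
      pi_complexNormal_one_real_le_sum h0 (fun i => (hneg _ i.succ_ne_zero).le) ht.le, mul_comm]
    congr 2
    have hprod : ∏ l ∈ Finset.univ.erase 0, (lam 0 - lam l)
        = ∏ i : Fin n, (lam 0 - lam i.succ) := by
      rw [← Finset.compl_singleton, ← Fin.image_succ_univ,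
        Finset.prod_image fun _ _ _ _ h => Fin.succ_injective _ h]
    have hpow : lam 0 ^ n = ∏ _i : Fin n, lam 0 := by simp
    rw [hprod, hpow, ← Finset.prod_div_distrib]
    refine Finset.prod_congr rfl fun i _ => ?_
    have h1 : 0 < lam 0 - lam i.succ := by linarith [hneg _ i.succ_ne_zero]
    have h2 : 1 + -lam i.succ / lam 0 = (lam 0 - lam i.succ) / lam 0 := by
      field_simp
      ring
    rw [h2, inv_div]
  · have huniv : {z : Fin (n + 1) → ℂ | ∑ i, lam i * Complex.normSq (z i) < t} = Set.univ := by
      refine Set.eq_univ_of_forall fun z => lt_of_le_of_lt (Finset.sum_nonpos fun i _ => ?_) ht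
      refine mul_nonpos_of_nonpos_of_nonneg ?_ (Complex.normSq_nonneg _)
      rcases eq_or_ne i 0 with rfl | hi
      · exact not_lt.mp h0
      · exact (hneg i hi).le
    rw [huniv, probReal_univ]

end SensorNet

theorem mainTheorem6 {Ω : Type*} [MeasurableSpace Ω] (μ : Measure Ω) [IsProbabilityMeasure μ]
    (N : ℕ) [NeZero N]
    (σθ2 σw2 PT Ppred ε γ : ℝ) (σv2 d : Fin N → ℝ)
    (hσθ : 0 ≤ σθ2) (hσw : 0 < σw2) (hPT : 0 < PT)
    (hσv : ∀ i, 0 < σv2 i) (hd : ∀ i, 0 < d i)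
    (hε : 0 < ε) (hεP : ε < Ppred)
    (g : Fin N → Ω → ℂ)
    (hlaw : ∀ i, HasLaw (g i) (SensorNet.complexNormal 1) μ)
    (hindep : iIndepFun g μ) :
    (∀ i : Fin N, i ≠ 0 → SensorNet.eigR Ppred ε PT σθ2 σv2 d γ i < 0) ∧
    μ.real {ω | ε < SensorNet.filteredMSE Ppred σw2 σv2 (SensorNet.equalGain PT σθ2 σv2)
        (SensorNet.channel d γ fun i => g i ω)} =
      if 0 < SensorNet.eigR Ppred ε PT σθ2 σv2 d γ 0 then
        1 - SensorNet.eigR Ppred ε PT σθ2 σv2 d γ 0 ^ (N - 1) /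
            (∏ l ∈ Finset.univ.erase (0 : Fin N),
              (SensorNet.eigR Ppred ε PT σθ2 σv2 d γ 0 - SensorNet.eigR Ppred ε PT σθ2 σv2 d γ l)) *
          Real.exp (-((Ppred - ε) * σw2 /
            (ε * Ppred * PT * SensorNet.eigR Ppred ε PT σθ2 σv2 d γ 0)))
      else 1 := by
  have hneg : ∀ i : Fin N, i ≠ 0 → SensorNet.eigR Ppred ε PT σθ2 σv2 d γ i < 0 :=
    fun i hi => SensorNet.eigR_neg PT γ hσθ hσv hd hε hεP hi
  refine ⟨hneg, ?_⟩
  have hN : Measurable Complex.normSq := Complex.continuous_normSq.measurable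
  obtain ⟨U, hU⟩ := SensorNet.exists_linearIsometryEquiv_lt_filteredMSE_iff (Ppred := Ppred)
    γ hσθ hσw hPT hσv hd hε hεP
  have hUm : Measurable U := U.continuous.measurable
  have hT : Measurable fun z : Fin N → ℂ => (U (WithLp.toLp 2 z)).ofLp := by fun_prop
  set lam := SensorNet.eigR Ppred ε PT σθ2 σv2 d γ with hlam
  set t := SensorNet.betaCoef Ppred ε * σw2 / PT with ht
  have ht0 : 0 < t := div_pos (mul_pos (SensorNet.betaCoef_pos hε hεP) hσw) hPT
  have hpi := iIndepFun.hasLaw_pi hlaw hindep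
  have hmp : HasLaw (fun z : Fin N → ℂ => (U (WithLp.toLp 2 z)).ofLp)
      (Measure.pi fun _ : Fin N => SensorNet.complexNormal 1)
      (Measure.pi fun _ : Fin N => SensorNet.complexNormal 1) :=
    ⟨hT.aemeasurable, SensorNet.map_linearIsometryEquiv_pi_complexNormal_one U⟩
  have hfin := (hmp.comp hpi).measureReal_eq
    (p := fun w : Fin N → ℂ => ∑ i, lam i * Complex.normSq (w i) < t)
    (measurableSet_lt (by fun_prop) measurable_const)
  simp only [Function.comp_apply] at hfin
  simp_rw [hU, hfin]
  have hexp : (Ppred - ε) * σw2 / (ε * Ppred * PT * lam 0) = t / lam 0 := by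
    rw [ht, SensorNet.betaCoef]
    simp only [div_eq_mul_inv, mul_inv]
    ring
  rw [hexp]
  -- Only the signs of `lam` and `t` matter from here; making them opaque allows `N` to be replaced
  -- by `n + 1`, with `N - 1` becoming `n`.
  clear_value lam t
  clear hfin hmp hpi hU hT hUm U hindep hlaw g hlam ht hexp
  obtain ⟨n, rfl⟩ : ∃ n, N = n + 1 := Nat.exists_eq_succ_of_ne_zero (NeZero.ne N)
  exact SensorNet.pi_complexNormal_one_real_sum_lt hneg ht0
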